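/- Let $S^1=\mathbb{R}/\mathbb{Z}$, that is, $[0,1]$ with its endpoints identified, and call a point of $S^1$ dyadic if it is the image of a dyadic rational number. Thompson's group $T$ is the group, under composition, of all piecewise linear homeomorphisms $f$ of $S^1$ that map the set of dyadic points onto itself, that are differentiable except at finitely many points, all of them dyadic, and whose derivative at every other point is $2^i$ for some $i\in\mathbb{Z}$. Theorem. $T$ has Serre's property FA: whenever $T$ acts by automorphisms on a simplicial tree $\Gamma$, there is a point of (the geometric realization of) $\Gamma$ that is fixed by every element of $T$. In particular, if the action is without inversions (every element of $T$ that leaves an edge invariant acts as the identity on that edge), then some vertex of $\Gamma$ is fixed by every element of $T$. -/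

import Mathlib

open Set Filter Topology

universe v

/-- A point of the circle `ℝ / ℤ` (that is, `[0, 1]` with its endpoints identified) is dyadic if it
is the image of a dyadic rational number `k / 2 ^ n`. -/
def IsDyadicPoint (x : AddCircle (1 : ℝ)) : Prop :=
  ∃ (k : ℤ) (n : ℕ), x = (((k : ℝ) / 2 ^ n : ℝ) : AddCircle (1 : ℝ))

/-- Near the point `x` the circle map `f` is affine, with slope an integral power of `2`. -/
def IsDyadicAffineNear (f : AddCircle (1 : ℝ) → AddCircle (1 : ℝ)) (x : ℝ) : Prop :=
  ∃ (n : ℤ) (c : ℝ), ∀ᶠ y : ℝ in 𝓝 x,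
    f (y : AddCircle (1 : ℝ)) = (((2 : ℝ) ^ n * y + c : ℝ) : AddCircle (1 : ℝ))

/-- The defining condition of Thompson's group `T` for a self-homeomorphism of the circle `ℝ / ℤ`:
it preserves the set of dyadic points and it is piecewise linear, where all breakpoints belong to a
finite set of dyadic points and all slopes are integral powers of `2`. -/
def IsThompsonT (f : AddCircle (1 : ℝ) ≃ₜ AddCircle (1 : ℝ)) : Prop :=
  (∀ x, IsDyadicPoint (f x) ↔ IsDyadicPoint x) ∧
    ∃ S : Set (AddCircle (1 : ℝ)), S.Finite ∧ (∀ s ∈ S, IsDyadicPoint s) ∧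
      ∀ x : ℝ, (x : AddCircle (1 : ℝ)) ∉ S → IsDyadicAffineNear f x

theorem IsThompsonT.one : IsThompsonT 1 := by
  refine ⟨fun x => Iff.rfl, ∅, Set.finite_empty, by simp, fun x _ => ⟨0, 0, ?_⟩⟩
  filter_upwards with y
  simp

theorem IsThompsonT.mul {f g : AddCircle (1 : ℝ) ≃ₜ AddCircle (1 : ℝ)}
    (hf : IsThompsonT f) (hg : IsThompsonT g) : IsThompsonT (f * g) := by
  obtain ⟨hfd, S, hSf, hSd, hS⟩ := hf
  obtain ⟨hgd, R, hRf, hRd, hR⟩ := hg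
  refine ⟨fun x => (hfd (g x)).trans (hgd x), R ∪ g ⁻¹' S,
    hRf.union (hSf.preimage g.injective.injOn), ?_, ?_⟩
  · rintro s (hs | hs)
    · exact hRd s hs
    · exact (hgd s).1 (hSd _ hs)
  · intro x hx
    simp only [Set.mem_union, Set.mem_preimage, not_or] at hx
    obtain ⟨n, c, hn⟩ := hR x hx.1
    have hxg := hn.self_of_nhds
    obtain ⟨m, d, hm⟩ := hS ((2 : ℝ) ^ n * x + c) (by rw [← hxg]; exact hx.2)
    refine ⟨m + n, (2 : ℝ) ^ m * c + d, ?_⟩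
    have ht : Tendsto (fun y : ℝ => (2 : ℝ) ^ n * y + c) (𝓝 x) (𝓝 ((2 : ℝ) ^ n * x + c)) :=
      Continuous.tendsto (by fun_prop) x
    filter_upwards [hn, ht.eventually hm] with y h1 h2
    change f (g y) = _
    rw [h1, h2, zpow_add₀ (by norm_num : (2 : ℝ) ≠ 0)]
    congr 1
    ring

theorem IsThompsonT.inv {f : AddCircle (1 : ℝ) ≃ₜ AddCircle (1 : ℝ)}
    (hf : IsThompsonT f) : IsThompsonT f⁻¹ := by
  obtain ⟨hfd, S, hSf, hSd, hS⟩ := hf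
  refine ⟨fun x => ?_, f '' S, hSf.image f, ?_, ?_⟩
  · change IsDyadicPoint (f.symm x) ↔ _
    rw [← hfd, f.apply_symm_apply]
  · rintro _ ⟨s, hs, rfl⟩
    exact (hfd s).2 (hSd s hs)
  · intro x hx
    obtain ⟨y₀, hy₀⟩ : ∃ y₀ : ℝ, (y₀ : AddCircle (1 : ℝ)) = f.symm (x : AddCircle (1 : ℝ)) :=
      QuotientAddGroup.mk_surjective _
    have hy : (y₀ : AddCircle (1 : ℝ)) ∉ S := by
      intro h
      exact hx ⟨_, h, by rw [hy₀, f.apply_symm_apply]⟩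
    obtain ⟨n, c, hn⟩ := hS y₀ hy
    have h0 := hn.self_of_nhds
    rw [hy₀, f.apply_symm_apply] at h0
    have hk : (((2 : ℝ) ^ n * y₀ + c - x : ℝ) : AddCircle (1 : ℝ)) = 0 := by
      rw [AddCircle.coe_sub, ← h0, sub_self]
    obtain ⟨k, hk⟩ := (AddCircle.coe_eq_zero_iff (1 : ℝ)).1 hk
    have h2 : (2 : ℝ) ^ n ≠ 0 := zpow_ne_zero n (by norm_num)
    have hk' : (2 : ℝ) ^ n * y₀ = x + k - c := by
      have : (k : ℝ) = (2 : ℝ) ^ n * y₀ + c - x := by simpa using hk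
      linarith
    have hinv : (2 : ℝ) ^ (-n) * (2 : ℝ) ^ n = 1 := by
      rw [zpow_neg, inv_mul_cancel₀ h2]
    have hx0 : (2 : ℝ) ^ (-n) * x + (2 : ℝ) ^ (-n) * (k - c) = y₀ := by
      calc (2 : ℝ) ^ (-n) * x + (2 : ℝ) ^ (-n) * (k - c)
          = (2 : ℝ) ^ (-n) * (x + k - c) := by ring
        _ = ((2 : ℝ) ^ (-n) * (2 : ℝ) ^ n) * y₀ := by rw [← hk']; ring
        _ = y₀ := by rw [hinv, one_mul]
    refine ⟨-n, (2 : ℝ) ^ (-n) * (k - c), ?_⟩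
    have ht : Tendsto (fun y : ℝ => (2 : ℝ) ^ (-n) * y + (2 : ℝ) ^ (-n) * (k - c)) (𝓝 x)
        (𝓝 y₀) := by
      have := Continuous.tendsto
        (f := fun y : ℝ => (2 : ℝ) ^ (-n) * y + (2 : ℝ) ^ (-n) * (k - c)) (by fun_prop) x
      rwa [hx0] at this
    filter_upwards [ht.eventually hn] with z hz
    change f.symm z = _
    rw [f.symm_apply_eq, hz]
    have e : (2 : ℝ) ^ n * ((2 : ℝ) ^ (-n) * z + (2 : ℝ) ^ (-n) * (k - c)) + c = z + k := by
      calc _ = ((2 : ℝ) ^ (-n) * (2 : ℝ) ^ n) * (z + k - c) + c := by ring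
        _ = z + k := by rw [hinv]; ring
    have hkz : ((k : ℝ) : AddCircle (1 : ℝ)) = 0 :=
      (AddCircle.coe_eq_zero_iff (1 : ℝ)).2 ⟨k, by simp⟩
    rw [e, AddCircle.coe_add, hkz, add_zero]

/-- Thompson's group `T`, a group of homeomorphisms of the circle `ℝ / ℤ` under composition. -/
def ThompsonT : Subgroup (AddCircle (1 : ℝ) ≃ₜ AddCircle (1 : ℝ)) where
  carrier := {f | IsThompsonT f}
  one_mem' := IsThompsonT.one
  mul_mem' := fun hf hg => hf.mul hg
  inv_mem' := fun hf => hf.inv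

/-- An action on a graph is without inversions if every group element that leaves an edge invariant
acts as the identity on that edge. -/
def ActsWithoutInversions {G V : Type*} [Group G] {Γ : SimpleGraph V} (ρ : G →* (Γ ≃g Γ)) : Prop :=
  ∀ (g : G), ∀ e ∈ Γ.edgeSet, e.map (ρ g) = e → ∀ v ∈ e, ρ g v = v

/-- Some vertex is fixed by the whole group. -/
def HasFixedVertex {G V : Type*} [Group G] {Γ : SimpleGraph V} (ρ : G →* (Γ ≃g Γ)) : Prop :=
  ∃ v : V, ∀ g : G, ρ g v = v

/-- Some point of the geometric realization of the graph is fixed by the whole group: either a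
vertex, or an interior point of an edge. In the second case the edge is invariant under the group,
and conversely the midpoint of an invariant edge is fixed. -/
def HasFixedPoint {G V : Type*} [Group G] {Γ : SimpleGraph V} (ρ : G →* (Γ ≃g Γ)) : Prop :=
  HasFixedVertex ρ ∨ ∃ e ∈ Γ.edgeSet, ∀ g : G, e.map (ρ g) = e

/-- Serre's property FA: every action of `G` by automorphisms on a simplicial tree has a global
fixed point in the tree, which can be chosen to be a vertex if the action is without inversions. -/
def HasPropertyFA (G : Type*) [Group G] : Prop :=
  ∀ (V : Type v) (Γ : SimpleGraph V), Γ.IsTree → ∀ ρ : G →* (Γ ≃g Γ),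
    HasFixedPoint ρ ∧ (ActsWithoutInversions ρ → HasFixedVertex ρ)

/-! `T` is generated by two torsion elements whose product is also torsion, and such a group has
little room to move on a tree. Let `a` be the quarter turn and `b` the order three map permuting
`[0, 1/2]`, `[1/2, 3/4]`, `[3/4, 1]` cyclically; then `a ^ 4 = b ^ 3 = (b * a) ^ 5 = 1`.

On a tree, an automorphism killed by an odd power fixes a vertex: otherwise it inverts an edge or
translates along an axis, and no odd power would be trivial. So `b⁻¹` and `b * a` each fix a vertex.
If two automorphisms have fixed vertices but no common one, their product moves a vertex arbitrarily
far; as `b⁻¹ * (b * a) = a` has finite order, `b⁻¹` and `b * a` share a fixed vertex. It is fixed by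
`a` and `b`, hence by everything they generate. Inversions never matter, because `a`, of even order,
is not required to fix a vertex beforehand.

For generation, dyadic intervals are coded by binary words. Every element of `T` is affine on the
pieces of some binary subdivision, with standard dyadic intervals as images. The subgroup generated
by `a` and `b` acts transitively on standard intervals of length at most `1/2`, which reduces the
claim to elements fixing `[0, 1/2]` pointwise. These are handled by induction on the number of
pieces of `[1/2, 1]`, using `shiftRoot` and `shiftRight`, which are words in `a` and `b`. -/

namespace SimpleGraph

/-! ### Fixed vertices of tree automorphisms -/

variable {V : Type*} {Γ : SimpleGraph V}

/-- Both vertices are the penultimate vertex of the unique path from `x` to `q`. -/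
theorem IsTree.eq_of_dist_eq_add_one (hΓ : Γ.IsTree) {x q u w : V} (hu : Γ.Adj q u)
    (hw : Γ.Adj q w) (hxu : Γ.dist x q = Γ.dist x u + 1) (hxw : Γ.dist x q = Γ.dist x w + 1) :
    u = w := by
  obtain ⟨p, hp⟩ := hΓ.connected.exists_walk_length_eq_dist x u
  obtain ⟨r, hr⟩ := hΓ.connected.exists_walk_length_eq_dist x w
  have h1 : (p.concat hu.symm).IsPath :=
    Walk.isPath_of_length_eq_dist _ (by rw [Walk.length_concat, hp, hxu])
  have h2 : (r.concat hw.symm).IsPath :=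
    Walk.isPath_of_length_eq_dist _ (by rw [Walk.length_concat, hr, hxw])
  have h := congrArg (fun s : Γ.Path x q => s.1.penultimate)
    ((hΓ.isAcyclic.subsingleton_path x q).elim ⟨_, h1⟩ ⟨_, h2⟩)
  simpa using h

theorem Connected.exists_adj_dist_eq (hΓ : Γ.Connected) {x y : V} (h : x ≠ y) :
    ∃ z, Γ.Adj x z ∧ Γ.dist x y = Γ.dist z y + 1 := by
  obtain ⟨p, hp⟩ := hΓ.exists_walk_length_eq_dist x y
  cases p with
  | nil => exact absurd rfl h
  | @cons _ z _ hz p =>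
    refine ⟨z, hz, le_antisymm ?_ ?_⟩
    · have := hΓ.dist_triangle (u := x) (v := z) (w := y)
      rw [dist_eq_one_iff_adj.2 hz] at this
      omega
    · have := dist_le p
      rw [Walk.length_cons] at hp
      omega

/-- A geodesic to `y` that begins by moving away from `x` keeps doing so: the only neighbour of `w`
closer to `x` is `q`, which the geodesic has already left. -/
theorem IsTree.dist_eq_dist_add_of_dist_eq_add_one (hΓ : Γ.IsTree) {x y : V} (n : ℕ) :
    ∀ q w : V, Γ.Adj q w → Γ.dist x w = Γ.dist x q + 1 → Γ.dist w y = n →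
      Γ.dist q y = n + 1 → Γ.dist x y = Γ.dist x q + (n + 1) := by
  induction n with
  | zero =>
    intro q w _ hxw hwy _
    rw [hΓ.connected.dist_eq_zero_iff] at hwy
    rw [← hwy, hxw]
  | succ n ih =>
    intro q w hqw hxw hwy hqy
    have hne : w ≠ y := by
      rintro rfl
      simp at hwy
    obtain ⟨z, hwz, hz⟩ := hΓ.connected.exists_adj_dist_eq hne
    have hzq : z ≠ q := by
      rintro rfl
      omega
    have hxz : Γ.dist x z = Γ.dist x w + 1 := by
      rcases hΓ.dist_eq_dist_add_one_of_adj x hwz with h | h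
      · exact absurd (hΓ.eq_of_dist_eq_add_one hwz hqw.symm h hxw) hzq
      · exact h
    rw [ih w z hwz hxz (by omega) hwy, hxw]
    omega

/-- If the geodesics from `q` to `x` and to `y` start along different edges, then `q` lies between
`x` and `y`. -/
theorem IsTree.dist_eq_add_of_ne (hΓ : Γ.IsTree) {x y q u w : V} (hu : Γ.Adj q u)
    (hw : Γ.Adj q w) (huw : u ≠ w) (hx : Γ.dist q x = Γ.dist u x + 1)
    (hy : Γ.dist q y = Γ.dist w y + 1) : Γ.dist x y = Γ.dist q x + Γ.dist q y := by
  rw [hy, dist_comm (u := q)]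
  refine hΓ.dist_eq_dist_add_of_dist_eq_add_one _ q w hw ?_ rfl hy
  rcases hΓ.dist_eq_dist_add_one_of_adj x hw with h | h
  · rw [dist_comm, dist_comm (u := u)] at hx
    exact absurd (hΓ.eq_of_dist_eq_add_one hu hw hx h) huw
  · exact h

theorem Iso.dist_apply (hΓ : Γ.Connected) (g : Γ ≃g Γ) (x y : V) :
    Γ.dist (g x) (g y) = Γ.dist x y := by
  have key : ∀ (g : Γ ≃g Γ) (x y : V), Γ.dist (g x) (g y) ≤ Γ.dist x y := by
    intro g x y
    obtain ⟨p, hp⟩ := hΓ.exists_walk_length_eq_dist x y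
    have := dist_le (p.map g.toHom)
    rwa [Walk.length_map, hp] at this
  refine le_antisymm (key g x y) ?_
  simpa using key g.symm (g x) (g y)

theorem Iso.mul_apply' (g h : Γ ≃g Γ) (x : V) : (g * h) x = g (h x) := rfl

/-- An automorphism of odd finite order of a tree fixes a vertex. -/
theorem IsTree.exists_apply_eq_self_of_odd (hΓ : Γ.IsTree) (c : Γ ≃g Γ) {n : ℕ} (hn : Odd n)
    (hc : c ^ n = 1) : ∃ x, c x = x := by
  have hconn := hΓ.connected
  have := hconn.nonempty
  -- `x` has minimal displacement, so, absent fixed vertices, it should lie on an axis or on an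
  -- inverted edge.
  obtain ⟨x, hx⟩ := (measure fun x => Γ.dist x (c x)).wf.has_min univ univ_nonempty
  replace hx : ∀ y, Γ.dist x (c x) ≤ Γ.dist y (c y) := fun y => not_lt.1 (hx.2 y trivial)
  by_contra! hfix
  obtain ⟨u, hu, hux⟩ := hconn.exists_adj_dist_eq (hfix x).symm
  obtain ⟨w, hw, hwx⟩ := hconn.exists_adj_dist_eq (hfix x)
  have hcu : Γ.Adj (c x) (c u) := c.map_adj_iff.2 hu
  have hne : w ≠ c u := by
    intro hwu
    -- If `u = c x`, then `c` swaps `x` and `c x`, so its odd powers move `x`. Otherwise `u` has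
    -- smaller displacement than `x`.
    rcases Nat.eq_zero_or_pos (Γ.dist u (c x)) with h0 | h0
    · have h1 : u = c x := (hconn.dist_eq_zero_iff).1 h0
      have h2 : Γ.dist w x = 0 := by
        rw [dist_comm (u := c x)] at hwx
        omega
      have h3 : c (c x) = x := by
        rw [← h1, ← hwu, (hconn.dist_eq_zero_iff).1 h2]
      obtain ⟨k, rfl⟩ := hn
      have h4 : ∀ k : ℕ, (c ^ (2 * k)) x = x := by
        intro k
        induction k with
        | zero => rfl
        | succ k ih =>
          rw [mul_add, mul_one, pow_add, Iso.mul_apply', pow_two, Iso.mul_apply', h3, ih]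
      have h5 : (c ^ (2 * k + 1)) x = x := by
        rw [hc]; rfl
      rw [pow_succ', Iso.mul_apply', h4] at h5
      exact hfix x h5
    · have h1 := hx u
      have h2 : u ≠ c x := by
        rintro h
        rw [h, dist_self] at h0
        exact lt_irrefl _ h0
      obtain ⟨z, hz, hzd⟩ := hconn.exists_adj_dist_eq h2.symm
      have h3 : z = w := by
        by_contra hzw
        have h4 : Γ.dist w x = Γ.dist x w := dist_comm
        have h5 : Γ.dist z u = Γ.dist u z := dist_comm
        have h6 : Γ.dist (c x) x = Γ.dist x (c x) := dist_comm
        have h7 : Γ.dist (c x) u = Γ.dist u (c x) := dist_comm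
        have h8 := hΓ.dist_eq_add_of_ne hz hw hzw hzd hwx
        rw [dist_comm, dist_eq_one_iff_adj.2 hu] at h8
        omega
      have h4 : Γ.dist u (c u) + 1 = Γ.dist u (c x) := by
        rw [← hwu, ← h3, dist_comm, ← hzd, dist_comm]
      omega
  -- As `w ≠ c u`, the translates of the geodesic from `x` to `c x` join without backtracking. The
  -- second clause records that the geodesic from `c ^ (k + 1) x` back to `x` starts at `c ^ k w`.
  have key : ∀ k : ℕ, Γ.dist ((c ^ (k + 1)) x) x = (k + 1) * Γ.dist x (c x) ∧
      Γ.dist ((c ^ (k + 1)) x) x = Γ.dist ((c ^ k) w) x + 1 := by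
    intro k
    induction k with
    | zero => simpa using ⟨dist_comm, hwx⟩
    | succ k ih =>
      obtain ⟨ih1, ih2⟩ := ih
      have e1 : ∀ z, (c ^ (k + 1)) z = (c ^ k) (c z) := fun z => by
        rw [pow_succ, Iso.mul_apply']
      have e2 : ∀ z, (c ^ (k + 1 + 1)) z = (c ^ k) (c (c z)) := fun z => by
        rw [pow_succ, pow_succ, Iso.mul_apply', Iso.mul_apply']
      have a1 : Γ.Adj ((c ^ (k + 1)) x) ((c ^ k) w) := by
        rw [e1]; exact (c ^ k).map_adj_iff.2 hw
      have a2 : Γ.Adj ((c ^ (k + 1)) x) ((c ^ (k + 1)) u) := (c ^ (k + 1)).map_adj_iff.2 hu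
      have a3 : (c ^ k) w ≠ (c ^ (k + 1)) u := by
        rw [e1]; exact fun h => hne ((c ^ k).injective h)
      have a4 : ∀ y, Γ.dist ((c ^ (k + 1)) y) ((c ^ (k + 1 + 1)) x) = Γ.dist y (c x) := by
        intro y
        rw [pow_succ c (k + 1), Iso.mul_apply', Iso.dist_apply hconn]
      have h1 := hΓ.dist_eq_add_of_ne a1 a2 a3 ih2
        (y := (c ^ (k + 1 + 1)) x) (by rw [a4, a4, hux])
      rw [a4, ih1, dist_comm] at h1
      refine ⟨by rw [h1]; ring, ?_⟩
      have b1 : Γ.Adj ((c ^ (k + 1)) (c x)) ((c ^ (k + 1)) w) := (c ^ (k + 1)).map_adj_iff.2 hw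
      have b2 : (c ^ (k + 1 + 1)) x = (c ^ (k + 1)) (c x) := by
        rw [pow_succ c (k + 1), Iso.mul_apply']
      rcases hΓ.dist_eq_dist_add_one_of_adj x b1 with h | h
      · rw [b2, dist_comm, h, dist_comm]
      · have t := hconn.dist_triangle (u := x) (v := (c ^ (k + 1)) x) (w := (c ^ (k + 1)) w)
        rw [h, ← b2, Iso.dist_apply hconn, dist_comm (u := x), dist_comm (u := x), ih1, h1] at t
        rw [dist_comm (u := c x), dist_comm (u := w)] at hwx
        omega
  obtain ⟨k, rfl⟩ := hn
  have h := (key (2 * k)).1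
  rw [hc] at h
  change Γ.dist x x = _ at h
  rw [dist_self] at h
  rcases Nat.mul_eq_zero.1 h.symm with h | h
  · omega
  · exact hfix x ((hconn.dist_eq_zero_iff).1 h).symm

/-- If two automorphisms of a tree have fixed vertices and their product has finite order, then
they have a common fixed vertex. -/
theorem IsTree.exists_common_fixed (hΓ : Γ.IsTree) (b c : Γ ≃g Γ) (hb : ∃ x, b x = x)
    (hc : ∃ x, c x = x) {n : ℕ} (hn : n ≠ 0) (hcb : (c * b) ^ n = 1) :
    ∃ x, b x = x ∧ c x = x := by
  have hconn := hΓ.connected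
  obtain ⟨x, hx⟩ := hb
  obtain ⟨y, hy⟩ := hc
  -- For a closest pair of fixed vertices, `b` and `c` must move the end edges of the geodesic
  -- between them.
  obtain ⟨⟨p, q⟩, ⟨hp, hq⟩, hmin⟩ := (measure fun z : V × V => Γ.dist z.1 z.2).wf.has_min
    {z | b z.1 = z.1 ∧ c z.2 = z.2} ⟨(x, y), hx, hy⟩
  replace hmin : ∀ r s, b r = r → c s = s → Γ.dist p q ≤ Γ.dist r s :=
    fun r s hr hs => not_lt.1 (hmin (r, s) ⟨hr, hs⟩)
  simp only at hp hq
  by_cases hpq : p = q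
  · exact ⟨p, hp, by rw [hpq, hq]⟩
  exfalso
  obtain ⟨v, hv, hvd⟩ := hconn.exists_adj_dist_eq hpq
  obtain ⟨u, hu, hud⟩ := hconn.exists_adj_dist_eq (Ne.symm hpq)
  have hbv : v ≠ b v := fun h => by have := hmin v q h.symm hq; omega
  have hcu : u ≠ c u := fun h => by
    have := hmin p u hp h.symm
    rw [dist_comm, hud, dist_comm (u := u)] at this
    omega
  -- A geodesic leaving a fixed vertex along a moved edge is turned away from that edge.
  have turn : ∀ (g : Γ ≃g Γ) (r s t z : V), g r = r → Γ.Adj r t → t ≠ g t →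
      Γ.dist r s = Γ.dist t s + 1 → Γ.dist r z = Γ.dist r s + Γ.dist s z →
      Γ.dist s (g z) = Γ.dist r s + Γ.dist r z := by
    intro g r s t z hr ht hgt hs hz
    have hgr : Γ.Adj r (g t) := by
      have := g.map_adj_iff.2 ht
      rwa [hr] at this
    have e1 : ∀ y, Γ.dist r (g y) = Γ.dist r y := fun y => by
      conv_lhs => rw [← hr]
      exact Iso.dist_apply hconn g r y
    rw [← e1 z]
    refine hΓ.dist_eq_add_of_ne ht hgr hgt hs ?_
    rw [e1, Iso.dist_apply hconn]
    -- Since `s` lies between `r` and `z`, the geodesic from `r` to `z` also starts along `t`.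
    rcases hΓ.dist_eq_dist_add_one_of_adj z ht with h | h
    · rwa [dist_comm, dist_comm (u := t)]
    · have := hconn.dist_triangle (u := t) (v := s) (w := z)
      rw [dist_comm, dist_comm (u := z)] at h
      omega
  have hpos : 0 < Γ.dist p q := hconn.pos_dist_of_ne hpq
  have hsymm : Γ.dist q p = Γ.dist p q := dist_comm
  -- Ping-pong: if `q` separates `p` from `z`, then `p` separates `q` from `b z`, so `q` separates
  -- `p` from `c (b z)`, and the distance to `q` grows.
  have key : ∀ k : ℕ, Γ.dist p (((c * b) ^ k) q) = Γ.dist p q + Γ.dist q (((c * b) ^ k) q) ∧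
      k ≤ Γ.dist q (((c * b) ^ k) q) := by
    intro k
    induction k with
    | zero =>
      change Γ.dist p q = Γ.dist p q + Γ.dist q q ∧ _
      simp
    | succ k ih =>
      obtain ⟨ih1, ih2⟩ := ih
      rw [pow_succ', Iso.mul_apply', Iso.mul_apply']
      set z := ((c * b) ^ k) q
      have h1 := turn b p q v z hp hv hbv hvd ih1
      have h2 : Γ.dist p (b z) = Γ.dist p z := by
        conv_lhs => rw [← hp]
        exact Iso.dist_apply hconn b p z
      have h3 : Γ.dist q (b z) = Γ.dist q p + Γ.dist p (b z) := by rw [h1, h2, hsymm]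
      have h4 := turn c q p u (b z) hq hu hcu hud h3
      have h5 : Γ.dist q (c (b z)) = Γ.dist q (b z) := by
        conv_lhs => rw [← hq]
        exact Iso.dist_apply hconn c q (b z)
      refine ⟨by rw [h4, h5, hsymm], ?_⟩
      omega
  have h := (key n).2
  rw [hcb] at h
  change n ≤ Γ.dist q q at h
  rw [dist_self] at h
  omega

end SimpleGraph

/-! ### Binary words and standard dyadic intervals -/

/-- The affine bijection from `[0, 1]` onto the standard dyadic interval of the binary word `u`. -/
noncomputable def stdMap : List Bool → ℝ → ℝ
  | [], s => s
  | b :: u, s => ((if b then 1 else 0) + stdMap u s) / 2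

theorem stdMap_append (u w : List Bool) (s : ℝ) :
    stdMap (u ++ w) s = stdMap u (stdMap w s) := by
  induction u with
  | nil => rfl
  | cons b u ih => simp only [List.cons_append, stdMap, ih]

theorem stdMap_eq (u : List Bool) (s : ℝ) : stdMap u s = stdMap u 0 + s / 2 ^ u.length := by
  induction u with
  | nil => simp [stdMap]
  | cons b u ih =>
    simp only [stdMap, List.length_cons]
    rw [ih, pow_succ]
    field_simp
    ring

theorem stdMap_zero_eq (u : List Bool) : ∃ k : ℤ, stdMap u 0 = k / 2 ^ u.length := by
  induction u with
  | nil => exact ⟨0, by simp [stdMap]⟩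
  | cons b u ih =>
    obtain ⟨k, hk⟩ := ih
    refine ⟨(if b then 2 ^ u.length else 0) + k, ?_⟩
    simp only [stdMap, List.length_cons]
    rw [hk, pow_succ]
    cases b <;> simp <;> field_simp

theorem stdMap_mem_Icc (u : List Bool) {s : ℝ} (hs : s ∈ Icc (0 : ℝ) 1) :
    stdMap u s ∈ Icc (0 : ℝ) 1 := by
  induction u with
  | nil => exact hs
  | cons b u ih =>
    obtain ⟨h0, h1⟩ := ih
    cases b <;> simp only [stdMap, mem_Icc] <;> constructor <;> norm_num <;> linarith

theorem stdMap_mem_Ioo (u : List Bool) {s : ℝ} (hs : s ∈ Ioo (0 : ℝ) 1) :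
    stdMap u s ∈ Ioo (0 : ℝ) 1 := by
  induction u with
  | nil => exact hs
  | cons b u ih =>
    obtain ⟨h0, h1⟩ := ih
    cases b <;> simp only [stdMap, mem_Ioo] <;> constructor <;> norm_num <;> linarith

theorem exists_stdMap_eq (x : ℝ) (hx : x ∈ Icc (0 : ℝ) 1) (n : ℕ) :
    ∃ u : List Bool, u.length = n ∧ ∃ s ∈ Icc (0 : ℝ) 1, stdMap u s = x := by
  induction n generalizing x with
  | zero => exact ⟨[], rfl, x, hx, rfl⟩
  | succ n ih =>
    rcases le_total x (1 / 2) with h | h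
    · obtain ⟨u, hu, s, hs, e⟩ := ih (2 * x) ⟨by linarith [hx.1], by linarith⟩
      exact ⟨false :: u, by simp [hu], s, hs, by simp [stdMap, e]⟩
    · obtain ⟨u, hu, s, hs, e⟩ := ih (2 * x - 1) ⟨by linarith, by linarith [hx.2]⟩
      exact ⟨true :: u, by simp [hu], s, hs, by simp [stdMap, e]⟩

/-- Every dyadic interval of length `2⁻ⁿ` and integral position agrees modulo `1` with a standard
one. -/
theorem exists_stdMap_coe_eq (n : ℕ) (l : ℤ) : ∃ v : List Bool, v.length = n ∧
    ∀ s : ℝ, (((l + s) / 2 ^ n : ℝ) : AddCircle (1 : ℝ)) = (stdMap v s : ℝ) := by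
  have key : ∀ (n : ℕ) (l : ℤ), ∃ v : List Bool, v.length = n ∧ ∃ k : ℤ,
      ∀ s : ℝ, (l + s) / 2 ^ n = stdMap v s + k := by
    intro n
    induction n with
    | zero => exact fun l => ⟨[], rfl, l, fun s => by simp [stdMap, add_comm]⟩
    | succ n ih =>
      intro l
      obtain ⟨v, hv, k, hk⟩ := ih l
      rcases Int.even_or_odd' k with ⟨j, rfl | rfl⟩
      · refine ⟨false :: v, by simp [hv], j, fun s => ?_⟩
        rw [pow_succ, ← div_div, hk]
        simp only [stdMap]
        push_cast
        ring
      · refine ⟨true :: v, by simp [hv], j, fun s => ?_⟩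
        rw [pow_succ, ← div_div, hk]
        simp only [stdMap]
        push_cast
        ring
  obtain ⟨v, hv, k, hk⟩ := key n l
  refine ⟨v, hv, fun s => ?_⟩
  rw [hk, AddCircle.coe_add, (AddCircle.coe_eq_zero_iff (1 : ℝ) (x := (k : ℝ))).2 ⟨k, by simp⟩,
    add_zero]

/-- Two words are incomparable if neither is a prefix of the other. -/
def WordIncomp : List Bool → List Bool → Prop
  | a :: u, b :: v => a ≠ b ∨ WordIncomp u v
  | _, _ => False

theorem WordIncomp.append_right {u v : List Bool} (h : WordIncomp u v) (w : List Bool) :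
    WordIncomp u (v ++ w) := by
  induction u generalizing v with
  | nil => cases v <;> exact h.elim
  | cons a u ih =>
    cases v with
    | nil => exact h.elim
    | cons b v => exact h.imp id ih

theorem WordIncomp.symm {u v : List Bool} (h : WordIncomp u v) : WordIncomp v u := by
  induction u generalizing v with
  | nil => cases v <;> exact h.elim
  | cons a u ih =>
    cases v with
    | nil => exact h.elim
    | cons b v => exact h.imp Ne.symm ih

theorem wordIncomp_or (u v : List Bool) :
    WordIncomp u v ∨ (∃ w, v = u ++ w) ∨ ∃ w, u = v ++ w := by
  induction u generalizing v with
  | nil => exact Or.inr (Or.inl ⟨v, rfl⟩)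
  | cons a u ih =>
    cases v with
    | nil => exact Or.inr (Or.inr ⟨_, rfl⟩)
    | cons b v =>
      by_cases hab : a = b
      · subst hab
        rcases ih v with h | ⟨w, rfl⟩ | ⟨w, rfl⟩
        · exact Or.inl (Or.inr h)
        · exact Or.inr (Or.inl ⟨w, rfl⟩)
        · exact Or.inr (Or.inr ⟨w, rfl⟩)
      · exact Or.inl (Or.inl hab)

theorem WordIncomp.stdMap_ne {u v : List Bool} (h : WordIncomp u v) {s t : ℝ}
    (hs : s ∈ Ioo (0 : ℝ) 1) (ht : t ∈ Ioo (0 : ℝ) 1) : stdMap u s ≠ stdMap v t := by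
  induction u generalizing v with
  | nil => cases v <;> exact h.elim
  | cons a u ih =>
    cases v with
    | nil => exact h.elim
    | cons b v =>
      intro e
      simp only [stdMap] at e
      have h1 := stdMap_mem_Ioo u hs
      have h2 := stdMap_mem_Ioo v ht
      obtain ⟨h1, h1'⟩ := h1
      obtain ⟨h2, h2'⟩ := h2
      rcases h with h | h
      · cases a <;> cases b <;> simp at h e <;> linarith
      · by_cases hab : a = b
        · subst hab
          exact ih h (by linarith)
        · cases a <;> cases b <;> simp at hab e <;> linarith

theorem coe_stdMap_ne {u v : List Bool} (h : WordIncomp u v) {s t : ℝ}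
    (hs : s ∈ Ioo (0 : ℝ) 1) (ht : t ∈ Ioo (0 : ℝ) 1) :
    ((stdMap u s : ℝ) : AddCircle (1 : ℝ)) ≠ (stdMap v t : ℝ) := by
  intro e
  have h1 := stdMap_mem_Ioo u hs
  have h2 := stdMap_mem_Ioo v ht
  rw [AddCircle.coe_eq_coe_iff_of_mem_Ico (p := (1 : ℝ)) (a := 0)] at e
  · exact h.stdMap_ne hs ht e
  · exact ⟨h1.1.le, by simpa using h1.2⟩
  · exact ⟨h2.1.le, by simpa using h2.2⟩

/-! ### Maps affine on standard intervals -/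

/-- The circle map `f` carries the standard interval of `u` affinely onto that of `v`. -/
def AffineOnWord (f : AddCircle (1 : ℝ) → AddCircle (1 : ℝ)) (u v : List Bool) : Prop :=
  ∀ s ∈ Icc (0 : ℝ) 1, f ((stdMap u s : ℝ) : AddCircle (1 : ℝ)) = (stdMap v s : ℝ)

namespace AffineOnWord

variable {f g : AddCircle (1 : ℝ) → AddCircle (1 : ℝ)} {u v w : List Bool}

theorem append (h : AffineOnWord f u v) (w : List Bool) :
    AffineOnWord f (u ++ w) (v ++ w) := fun s hs => by
  rw [stdMap_append, stdMap_append]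
  exact h _ (stdMap_mem_Icc w hs)

theorem comp (hf : AffineOnWord f v w) (hg : AffineOnWord g u v) :
    AffineOnWord (f ∘ g) u w := fun s hs => by
  rw [Function.comp_apply, hg s hs, hf s hs]

theorem join (h0 : AffineOnWord f (u ++ [false]) (v ++ [false]))
    (h1 : AffineOnWord f (u ++ [true]) (v ++ [true])) : AffineOnWord f u v := fun s hs => by
  rcases le_total s (1 / 2) with h | h
  · have := h0 (2 * s) ⟨by linarith [hs.1], by linarith⟩
    rw [stdMap_append, stdMap_append] at this
    simpa [stdMap] using this
  · have := h1 (2 * s - 1) ⟨by linarith, by linarith [hs.2]⟩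
    rw [stdMap_append, stdMap_append] at this
    simpa [stdMap] using this

/-- If one image contained the other, the midpoint of the smaller would have preimages in the
interiors of both source intervals. -/
theorem incomp (hf : Function.Injective f) {u' v' : List Bool} (h : AffineOnWord f u v)
    (h' : AffineOnWord f u' v') (hu : WordIncomp u u') : WordIncomp v v' := by
  have half : (1 / 2 : ℝ) ∈ Ioo (0 : ℝ) 1 := by constructor <;> norm_num
  rcases wordIncomp_or v v' with hv | ⟨w, rfl⟩ | ⟨w, rfl⟩
  · exact hv
  · have e := (h.append w (1 / 2) (Ioo_subset_Icc_self half)).trans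
      (h' (1 / 2) (Ioo_subset_Icc_self half)).symm
    exact absurd (hf e) (coe_stdMap_ne (hu.symm.append_right w).symm half half)
  · have e := (h'.append w (1 / 2) (Ioo_subset_Icc_self half)).trans
      (h (1 / 2) (Ioo_subset_Icc_self half)).symm
    exact absurd (hf e) (coe_stdMap_ne (hu.append_right w).symm half half)

end AffineOnWord

theorem AffineOnWord.symm {f : AddCircle (1 : ℝ) ≃ₜ AddCircle (1 : ℝ)} {u v : List Bool}
    (h : AffineOnWord f u v) : AffineOnWord (f⁻¹ : AddCircle (1 : ℝ) ≃ₜ AddCircle (1 : ℝ)) v u :=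
  fun s hs => by
    change f.symm _ = _
    rw [f.symm_apply_eq, h s hs]

theorem AffineOnWord.mul {f g : AddCircle (1 : ℝ) ≃ₜ AddCircle (1 : ℝ)} {u v w : List Bool}
    (hf : AffineOnWord f v w) (hg : AffineOnWord g u v) :
    AffineOnWord (f * g : AddCircle (1 : ℝ) ≃ₜ AddCircle (1 : ℝ)) u w :=
  fun s hs => by
    change f (g _) = _
    rw [hg s hs, hf s hs]

theorem affineOnWord_one (u : List Bool) :
    AffineOnWord (1 : AddCircle (1 : ℝ) ≃ₜ AddCircle (1 : ℝ)) u u := fun _ _ => rfl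

theorem coe_intCast_eq_zero (k : ℤ) : ((k : ℝ) : AddCircle (1 : ℝ)) = 0 :=
  (AddCircle.coe_eq_zero_iff (1 : ℝ)).2 ⟨k, by simp⟩

theorem exists_eq_add_int_of_coe_eq {x y : ℝ} (h : (x : AddCircle (1 : ℝ)) = y) :
    ∃ k : ℤ, x = y + k := by
  rw [← sub_eq_zero, ← AddCircle.coe_sub] at h
  obtain ⟨k, hk⟩ := (AddCircle.coe_eq_zero_iff (1 : ℝ)).1 h
  exact ⟨k, by simp at hk; linarith⟩

theorem isDyadicPoint_coe_iff (x : ℝ) :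
    IsDyadicPoint (x : AddCircle (1 : ℝ)) ↔ ∃ (k : ℤ) (n : ℕ), x = k / 2 ^ n := by
  constructor
  · rintro ⟨k, n, h⟩
    obtain ⟨j, hj⟩ := exists_eq_add_int_of_coe_eq h
    refine ⟨k + j * 2 ^ n, n, ?_⟩
    rw [hj]
    push_cast
    field_simp
  · rintro ⟨k, n, rfl⟩
    exact ⟨k, n, rfl⟩

theorem isDyadicPoint_coe_stdMap_iff (u : List Bool) (s : ℝ) :
    IsDyadicPoint ((stdMap u s : ℝ) : AddCircle (1 : ℝ)) ↔
      IsDyadicPoint (s : AddCircle (1 : ℝ)) := by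
  induction u with
  | nil => rfl
  | cons b u ih =>
    rw [← ih]
    simp only [isDyadicPoint_coe_iff, stdMap]
    constructor
    · rintro ⟨k, n, h⟩
      refine ⟨2 * k - (if b then 2 ^ n else 0), n, ?_⟩
      have h' : stdMap u s = 2 * (k / 2 ^ n) - (if b then 1 else 0) := by linarith
      rw [h']
      cases b <;> simp <;> field_simp
    · rintro ⟨k, n, h⟩
      refine ⟨k + (if b then 2 ^ n else 0), n + 1, ?_⟩
      rw [h, pow_succ]
      cases b <;> simp <;> field_simp
      ring

theorem AffineOnWord.isDyadicAffineNear {f : AddCircle (1 : ℝ) → AddCircle (1 : ℝ)}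
    {u v : List Bool} (h : AffineOnWord f u v) {s x : ℝ} (hs : s ∈ Ioo (0 : ℝ) 1)
    (hx : (x : AddCircle (1 : ℝ)) = (stdMap u s : ℝ)) : IsDyadicAffineNear f x := by
  obtain ⟨k, hk⟩ := exists_eq_add_int_of_coe_eq hx
  have hpow : (2 : ℝ) ^ u.length ≠ 0 := by positivity
  have hpow' : (2 : ℝ) ^ v.length ≠ 0 := by positivity
  refine ⟨(u.length : ℤ) - v.length,
    stdMap v 0 - 2 ^ ((u.length : ℤ) - v.length) * (k + stdMap u 0), ?_⟩
  have ht : Tendsto (fun y : ℝ => (y - k - stdMap u 0) * 2 ^ u.length) (𝓝 x) (𝓝 s) := by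
    have := Continuous.tendsto (f := fun y : ℝ => (y - k - stdMap u 0) * 2 ^ u.length)
      (by fun_prop) x
    have e : (x - k - stdMap u 0) * 2 ^ u.length = s := by
      rw [hk, stdMap_eq u s]
      field_simp
      ring
    simpa only [e] using this
  filter_upwards [ht.eventually (isOpen_Ioo.mem_nhds hs)] with y hy
  have e : y = stdMap u ((y - k - stdMap u 0) * 2 ^ u.length) + k := by
    rw [stdMap_eq u (_ * _)]
    field_simp
    ring
  conv_lhs => rw [e, AddCircle.coe_add, coe_intCast_eq_zero, add_zero]
  rw [h _ (Ioo_subset_Icc_self hy), stdMap_eq v, zpow_sub₀ two_ne_zero, zpow_natCast, zpow_natCast]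
  congr 1
  field_simp
  ring

/-- A homeomorphism that is affine on finitely many standard intervals covering the circle, and
carries them to standard intervals, belongs to Thompson's group. -/
theorem isThompsonT_of_affineOnWord (f : AddCircle (1 : ℝ) ≃ₜ AddCircle (1 : ℝ))
    (W : Set (List Bool)) (hW : W.Finite) (hf : ∀ u ∈ W, ∃ v, AffineOnWord f u v)
    (hcov : ∀ x : ℝ, x ∈ Icc (0 : ℝ) 1 → ∃ u ∈ W, ∃ s ∈ Icc (0 : ℝ) 1, stdMap u s = x) :
    IsThompsonT f := by
  have hcov' : ∀ x : AddCircle (1 : ℝ), ∃ u ∈ W, ∃ s ∈ Icc (0 : ℝ) 1,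
      x = (stdMap u s : ℝ) := by
    intro x
    obtain ⟨y, hy, rfl⟩ := AddCircle.eq_coe_Ico x
    obtain ⟨u, hu, s, hs, e⟩ := hcov y (Ico_subset_Icc_self hy)
    exact ⟨u, hu, s, hs, by rw [e]⟩
  refine ⟨fun x => ?_, (fun u => ((stdMap u 0 : ℝ) : AddCircle (1 : ℝ))) '' W ∪
    (fun u => ((stdMap u 1 : ℝ) : AddCircle (1 : ℝ))) '' W, (hW.image _).union (hW.image _),
    ?_, fun x hx => ?_⟩
  · obtain ⟨u, hu, s, hs, rfl⟩ := hcov' x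
    obtain ⟨v, hv⟩ := hf u hu
    rw [hv s hs, isDyadicPoint_coe_stdMap_iff, isDyadicPoint_coe_stdMap_iff]
  · rintro _ (⟨u, _, rfl⟩ | ⟨u, _, rfl⟩)
    · exact (isDyadicPoint_coe_stdMap_iff u 0).2 ⟨0, 0, by simp⟩
    · exact (isDyadicPoint_coe_stdMap_iff u 1).2 ⟨1, 0, by simp⟩
  · obtain ⟨u, hu, s, hs, e⟩ := hcov' x
    obtain ⟨v, hv⟩ := hf u hu
    refine hv.isDyadicAffineNear ⟨hs.1.lt_of_ne ?_, hs.2.lt_of_ne ?_⟩ e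
    · rintro rfl
      exact hx (Or.inl ⟨u, hu, e.symm⟩)
    · rintro rfl
      exact hx (Or.inr ⟨u, hu, e.symm⟩)

/-! ### Elements of `T` are affine on a dyadic subdivision -/

/-- The difference of the two real formulas is continuous and integer valued near `x`, hence locally
constant. -/
theorem eq_and_of_eventually_coe_eq {n m : ℤ} {c d x : ℝ}
    (h : ∀ᶠ y : ℝ in 𝓝 x, (((2 : ℝ) ^ n * y + c : ℝ) : AddCircle (1 : ℝ)) =
      (((2 : ℝ) ^ m * y + d : ℝ) : AddCircle (1 : ℝ))) :
    n = m ∧ (c : AddCircle (1 : ℝ)) = d := by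
  obtain ⟨k, hk⟩ := exists_eq_add_int_of_coe_eq h.self_of_nhds
  have hcont : Tendsto (fun y : ℝ => (2 : ℝ) ^ n * y + c - ((2 : ℝ) ^ m * y + d)) (𝓝 x)
      (𝓝 (k : ℝ)) := by
    have := Continuous.tendsto
      (f := fun y : ℝ => (2 : ℝ) ^ n * y + c - ((2 : ℝ) ^ m * y + d)) (by fun_prop) x
    simpa only [show (2 : ℝ) ^ n * x + c - ((2 : ℝ) ^ m * x + d) = k by linarith] using this
  have hnear : Ioo ((k : ℝ) - 1) (k + 1) ∈ 𝓝 (k : ℝ) :=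
    isOpen_Ioo.mem_nhds ⟨by linarith, by linarith⟩
  have hev : ∀ᶠ y : ℝ in 𝓝 x, (2 : ℝ) ^ n * y + c - ((2 : ℝ) ^ m * y + d) = k := by
    filter_upwards [h, hcont.eventually hnear] with y hy hy'
    obtain ⟨j, hj⟩ := exists_eq_add_int_of_coe_eq hy
    have e : (2 : ℝ) ^ n * y + c - ((2 : ℝ) ^ m * y + d) = j := by linarith
    rw [e] at hy' ⊢
    have h1 : k - 1 < j := by exact_mod_cast hy'.1
    have h2 : j < k + 1 := by exact_mod_cast hy'.2
    have : j = k := by omega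
    rw [this]
  obtain ⟨y, hy, hxy⟩ : ∃ y, (2 : ℝ) ^ n * y + c - ((2 : ℝ) ^ m * y + d) = k ∧ x < y := by
    have h1 : ∀ᶠ y : ℝ in 𝓝[>] x, (2 : ℝ) ^ n * y + c - ((2 : ℝ) ^ m * y + d) = k :=
      hev.filter_mono nhdsWithin_le_nhds
    exact (h1.and self_mem_nhdsWithin).exists
  have h0 : ((2 : ℝ) ^ n - (2 : ℝ) ^ m) * (y - x) = 0 := by linarith
  have h1 : (2 : ℝ) ^ n = (2 : ℝ) ^ m := by
    rcases mul_eq_zero.1 h0 with h | h <;> linarith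
  refine ⟨zpow_right_injective₀ two_pos (by norm_num) h1, ?_⟩
  rw [h1] at hk
  rw [show c = d + k by linarith, AddCircle.coe_add, coe_intCast_eq_zero, add_zero]

/-- A continuous circle map that is locally affine on an open interval is affine on the closed
interval. -/
theorem exists_affine_on_Icc {f : AddCircle (1 : ℝ) → AddCircle (1 : ℝ)} (hf : Continuous f)
    {a b : ℝ} (hab : a < b) (h : ∀ x ∈ Ioo a b, IsDyadicAffineNear f x) :
    ∃ (n : ℤ) (c : ℝ), ∀ x ∈ Icc a b,
      f (x : AddCircle (1 : ℝ)) = (((2 : ℝ) ^ n * x + c : ℝ) : AddCircle (1 : ℝ)) := by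
  obtain ⟨x₀, hx₀⟩ := nonempty_Ioo.2 hab
  obtain ⟨n, c, hnc⟩ := h x₀ hx₀
  refine ⟨n, c, ?_⟩
  let U : Set ℝ := {x | ∀ᶠ y : ℝ in 𝓝 x,
    f (y : AddCircle (1 : ℝ)) = (((2 : ℝ) ^ n * y + c : ℝ) : AddCircle (1 : ℝ))}
  -- `W` collects the points with another germ, the constant counting only modulo `1`. Connectedness
  -- of `Ioo a b` excludes them.
  let W : Set ℝ := {x | ∃ (m : ℤ) (d : ℝ), ¬ (m = n ∧ (d : AddCircle (1 : ℝ)) = c) ∧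
    ∀ᶠ y : ℝ in 𝓝 x,
      f (y : AddCircle (1 : ℝ)) = (((2 : ℝ) ^ m * y + d : ℝ) : AddCircle (1 : ℝ))}
  have hU : IsOpen U := isOpen_setOfPred_eventually_nhds
  have hW : IsOpen W := by
    rw [isOpen_iff_mem_nhds]
    rintro x ⟨m, d, hne, hx⟩
    filter_upwards [hx.eventually_nhds] with y hy
    exact ⟨m, d, hne, hy⟩
  have hUW : Disjoint U W := by
    rw [Set.disjoint_left]
    rintro x hx ⟨m, d, hne, hx'⟩
    refine hne (eq_and_of_eventually_coe_eq (x := x) ?_)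
    filter_upwards [hx, hx'] with y hy hy'
    rw [← hy, ← hy']
  have hcov : Ioo a b ⊆ U ∪ W := by
    intro x hx
    obtain ⟨m, d, hmd⟩ := h x hx
    by_cases hm : m = n ∧ (d : AddCircle (1 : ℝ)) = c
    · left
      obtain ⟨rfl, hd⟩ := hm
      filter_upwards [hmd] with y hy
      rw [hy, AddCircle.coe_add, hd, ← AddCircle.coe_add]
    · exact Or.inr ⟨m, d, hm, hmd⟩
  have hsub : Ioo a b ⊆ U :=
    isPreconnected_Ioo.subset_left_of_subset_union hU hW hUW hcov ⟨x₀, hx₀, hnc⟩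
  have hclosed : IsClosed {x : ℝ | f (x : AddCircle (1 : ℝ)) =
      (((2 : ℝ) ^ n * x + c : ℝ) : AddCircle (1 : ℝ))} :=
    isClosed_eq (hf.comp (AddCircle.continuous_mk' 1))
      ((AddCircle.continuous_mk' 1).comp (by fun_prop))
  rw [← closure_Ioo hab.ne]
  exact closure_minimal (fun x hx => (hsub hx).self_of_nhds) hclosed

theorem exists_common_denominator {S : Set (AddCircle (1 : ℝ))} (hS : S.Finite)
    (hd : ∀ s ∈ S, IsDyadicPoint s) :
    ∃ N : ℕ, ∀ s ∈ S, ∃ k : ℤ, s = ((k / 2 ^ N : ℝ) : AddCircle (1 : ℝ)) := by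
  induction S, hS using Set.Finite.induction_on with
  | empty => exact ⟨0, by simp⟩
  | @insert a S _ _ ih =>
    obtain ⟨N, hN⟩ := ih fun s hs => hd s (mem_insert_of_mem _ hs)
    obtain ⟨k, n, hk⟩ := hd a (mem_insert _ _)
    refine ⟨N + n, ?_⟩
    rintro s (rfl | hs)
    · refine ⟨k * 2 ^ N, ?_⟩
      rw [hk]
      congr 1
      push_cast
      rw [pow_add]
      field_simp
    · obtain ⟨j, rfl⟩ := hN s hs
      refine ⟨j * 2 ^ n, ?_⟩
      congr 1
      push_cast
      rw [pow_add]
      field_simp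

/-- Finite rooted binary trees, which encode subdivisions of a standard dyadic interval. -/
inductive BinTree : Type
  | leaf : BinTree
  | node : BinTree → BinTree → BinTree

/-- On every interval of the subdivision `t` of the standard interval of `u`, the map `f` is affine
with image a standard interval. -/
def AffineOnTree (f : AddCircle (1 : ℝ) → AddCircle (1 : ℝ)) : BinTree → List Bool → Prop
  | .leaf, u => ∃ v, AffineOnWord f u v
  | .node a b, u => AffineOnTree f a (u ++ [false]) ∧ AffineOnTree f b (u ++ [true])

theorem exists_affineOnTree_of_length {f : AddCircle (1 : ℝ) → AddCircle (1 : ℝ)} (m : ℕ)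
    (u : List Bool) (h : ∀ w : List Bool, w.length = m → ∃ t, AffineOnTree f t (u ++ w)) :
    ∃ t, AffineOnTree f t u := by
  induction m generalizing u with
  | zero => simpa using h [] rfl
  | succ m ih =>
    obtain ⟨a, ha⟩ := ih (u ++ [false]) fun w hw => by
      simpa using h (false :: w) (by simp [hw])
    obtain ⟨b, hb⟩ := ih (u ++ [true]) fun w hw => by
      simpa using h (true :: w) (by simp [hw])
    exact ⟨.node a b, ha, hb⟩

/-- Subdividing to the common denominator of the breakpoints makes `f` affine on each piece;
subdividing further makes the images standard. -/
theorem IsThompsonT.exists_affineOnTree {f : AddCircle (1 : ℝ) ≃ₜ AddCircle (1 : ℝ)}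
    (hf : IsThompsonT f) (u : List Bool) : ∃ t, AffineOnTree f t u := by
  obtain ⟨hd, S, hS, hSd, haff⟩ := hf
  obtain ⟨N, hN⟩ := exists_common_denominator hS hSd
  refine exists_affineOnTree_of_length N u fun w hw => ?_
  generalize hx : u ++ w = x
  have hNx : N ≤ x.length := by simp [← hx, hw]
  have hpow : (0 : ℝ) < 2 ^ x.length := by positivity
  have hstd := stdMap_eq x
  have hnear : ∀ y ∈ Ioo (stdMap x 0) (stdMap x 1), IsDyadicAffineNear f y := by
    intro y hy
    -- A breakpoint inside the interval would give an integer strictly between `l` and `l + 1`.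
    refine haff y fun hyS => ?_
    obtain ⟨k, hk⟩ := hN _ hyS
    obtain ⟨j, hj⟩ := exists_eq_add_int_of_coe_eq hk
    obtain ⟨l, hl⟩ := stdMap_zero_eq x
    obtain ⟨i, hi⟩ := Nat.exists_eq_add_of_le hNx
    have e : y = ((k * 2 ^ i + j * 2 ^ x.length : ℤ) : ℝ) / 2 ^ x.length := by
      rw [hj, hi, pow_add]
      push_cast
      rw [pow_add]
      field_simp
    rw [hstd 1, hl, ← add_div, e, mem_Ioo, div_lt_div_iff_of_pos_right hpow,
      div_lt_div_iff_of_pos_right hpow] at hy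
    have h1 : l < k * 2 ^ i + j * 2 ^ x.length := by exact_mod_cast hy.1
    have h2 : k * 2 ^ i + j * 2 ^ x.length < l + 1 := by exact_mod_cast hy.2
    omega
  have hlt : stdMap x 0 < stdMap x 1 := by
    rw [hstd 1]
    have : (0 : ℝ) < 1 / 2 ^ x.length := by positivity
    linarith
  obtain ⟨n, c, hnc⟩ := exists_affine_on_Icc f.continuous hlt hnear
  have hmem : ∀ s ∈ Icc (0 : ℝ) 1, stdMap x s ∈ Icc (stdMap x 0) (stdMap x 1) := by
    intro s hs
    rw [hstd s, hstd 1]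
    refine ⟨?_, ?_⟩
    · have := div_nonneg hs.1 hpow.le
      linarith
    · have := div_le_div_of_nonneg_right hs.2 hpow.le
      linarith
  obtain ⟨d, e, hde⟩ : ∃ (d : ℤ) (e : ℕ), (2 : ℝ) ^ n * stdMap x 0 + c = d / 2 ^ e := by
    rw [← isDyadicPoint_coe_iff, ← hnc _ (left_mem_Icc.2 hlt.le), hd,
      isDyadicPoint_coe_stdMap_iff]
    exact ⟨0, 0, by simp⟩
  -- This depth makes `M` below nonnegative: the image has length `2 ^ (-(M + e))` and its left
  -- endpoint is an integral multiple of that length.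
  refine exists_affineOnTree_of_length (e + n.natAbs) x fun w hw => ⟨.leaf, ?_⟩
  obtain ⟨M, hM⟩ : ∃ M : ℕ, (M : ℤ) = x.length + w.length - n - e :=
    ⟨((x.length : ℤ) + w.length - n - e).toNat, by rw [Int.toNat_of_nonneg]; omega⟩
  obtain ⟨k, hk⟩ := stdMap_zero_eq w
  obtain ⟨v, -, hv⟩ := exists_stdMap_coe_eq (M + e) (d * 2 ^ M + k)
  refine ⟨v, fun s hs => ?_⟩
  rw [stdMap_append, hnc _ (hmem _ (stdMap_mem_Icc w hs)), ← hv]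
  congr 1
  rw [hstd (stdMap w s), mul_add, add_right_comm, hde, stdMap_eq w s, hk]
  have h2 : (2 : ℝ) ^ n = 2 ^ x.length * 2 ^ w.length / (2 ^ M * 2 ^ e) := by
    rw [eq_div_iff (by positivity)]
    simp only [← zpow_natCast]
    rw [← zpow_add₀ two_ne_zero, ← zpow_add₀ two_ne_zero, ← zpow_add₀ two_ne_zero]
    congr 1
    omega
  rw [h2, pow_add]
  push_cast
  field_simp
  ring

@[simp] theorem wordIncomp_nil_left (v : List Bool) : WordIncomp [] v ↔ False := by
  cases v <;> rfl

@[simp] theorem wordIncomp_nil_right (u : List Bool) : WordIncomp u [] ↔ False := by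
  cases u <;> rfl

@[simp] theorem wordIncomp_cons_cons (a b : Bool) (u v : List Bool) :
    WordIncomp (a :: u) (b :: v) ↔ a ≠ b ∨ WordIncomp u v := Iff.rfl

theorem eq_one_of_affineOnWord_nil {f : AddCircle (1 : ℝ) ≃ₜ AddCircle (1 : ℝ)}
    (h : AffineOnWord f [] []) : f = 1 := by
  ext x
  obtain ⟨y, hy, rfl⟩ := AddCircle.eq_coe_Ico x
  exact h y (Ico_subset_Icc_self hy)

/-! ### The two torsion generators -/

/-- The rotation of the circle by a quarter turn. -/
noncomputable def quarterTurn : AddCircle (1 : ℝ) ≃ₜ AddCircle (1 : ℝ) :=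
  Homeomorph.addRight ((1 / 4 : ℝ) : AddCircle (1 : ℝ))

theorem quarterTurn_coe (x : ℝ) : quarterTurn (x : AddCircle (1 : ℝ)) = ((x + 1 / 4 : ℝ) :) :=
  (AddCircle.coe_add (1 : ℝ) x (1 / 4)).symm

theorem quarterTurn_00 : AffineOnWord quarterTurn [false, false] [false, true] := fun s _ => by
  rw [quarterTurn_coe]
  congr 1
  simp [stdMap]
  ring

theorem quarterTurn_01 : AffineOnWord quarterTurn [false, true] [true, false] := fun s _ => by
  rw [quarterTurn_coe]
  congr 1
  simp [stdMap]
  ring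

theorem quarterTurn_10 : AffineOnWord quarterTurn [true, false] [true, true] := fun s _ => by
  rw [quarterTurn_coe]
  congr 1
  simp [stdMap]
  ring

theorem coe_eq_coe_of_eq_add_one {x y : ℝ} (h : x = y + 1) :
    (x : AddCircle (1 : ℝ)) = y := by
  rw [h, AddCircle.coe_add_period]

theorem quarterTurn_11 : AffineOnWord quarterTurn [true, true] [false, false] := fun s _ => by
  rw [quarterTurn_coe]
  refine coe_eq_coe_of_eq_add_one ?_
  simp [stdMap]
  ring

/-- The lift to the line of the order three rotation of the intervals `[0, 1/2]`, `[1/2, 3/4]`,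
`[3/4, 1]`. -/
noncomputable def thirdTurnLift (x : ℝ) : ℝ := max (1 / 2 + x / 2) (max (x + 1 / 4) (2 * x - 1 / 2))

/-- The order three map of the circle that permutes the intervals `[0, 1/2]`, `[1/2, 3/4]`,
`[3/4, 1]` cyclically. -/
noncomputable def thirdTurnFun : AddCircle (1 : ℝ) → AddCircle (1 : ℝ) :=
  AddCircle.liftIco 1 0 fun x => ((thirdTurnLift x : ℝ) : AddCircle (1 : ℝ))

theorem thirdTurnLift_one : ((thirdTurnLift 0 : ℝ) : AddCircle (1 : ℝ)) = thirdTurnLift 1 := by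
  refine (coe_eq_coe_of_eq_add_one ?_).symm
  norm_num [thirdTurnLift]

theorem continuous_thirdTurnFun : Continuous thirdTurnFun := by
  refine AddCircle.liftIco_zero_continuous thirdTurnLift_one (Continuous.continuousOn ?_)
  refine (AddCircle.continuous_mk' 1).comp ?_
  unfold thirdTurnLift
  fun_prop

theorem thirdTurnFun_coe {x : ℝ} (hx : x ∈ Icc (0 : ℝ) 1) :
    thirdTurnFun (x : AddCircle (1 : ℝ)) = (thirdTurnLift x : ℝ) := by
  rcases hx.2.lt_or_eq with h | rfl
  · exact AddCircle.liftIco_zero_coe_apply ⟨hx.1, h⟩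
  · rw [coe_eq_coe_of_eq_add_one (zero_add (1 : ℝ)).symm, ← thirdTurnLift_one]
    exact AddCircle.liftIco_zero_coe_apply ⟨le_rfl, one_pos⟩

theorem thirdTurnFun_0 : AffineOnWord thirdTurnFun [false] [true, false] := fun s hs => by
  rw [thirdTurnFun_coe (stdMap_mem_Icc _ hs)]
  obtain ⟨h0, h1⟩ := hs
  congr 1
  simp only [stdMap, thirdTurnLift, Bool.false_eq_true, if_false, if_true]
  -- The slopes `1/2`, `1`, `2` increase, so the lift is convex and each affine piece is the maximum
  -- on its own interval.
  rw [max_eq_left (max_le (by linarith) (by linarith))]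
  ring

theorem thirdTurnFun_10 : AffineOnWord thirdTurnFun [true, false] [true, true] := fun s hs => by
  rw [thirdTurnFun_coe (stdMap_mem_Icc _ hs)]
  obtain ⟨h0, h1⟩ := hs
  congr 1
  simp only [stdMap, thirdTurnLift, Bool.false_eq_true, if_false, if_true]
  rw [max_eq_left (a := _ + 1 / 4) (by linarith), max_eq_right (by linarith)]
  ring

theorem thirdTurnFun_11 : AffineOnWord thirdTurnFun [true, true] [false] := fun s hs => by
  rw [thirdTurnFun_coe (stdMap_mem_Icc _ hs)]
  obtain ⟨h0, h1⟩ := hs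
  refine coe_eq_coe_of_eq_add_one ?_
  simp only [stdMap, thirdTurnLift, Bool.false_eq_true, if_false, if_true]
  rw [max_eq_right (a := _ + 1 / 4) (by linarith), max_eq_right (by linarith)]
  ring

theorem thirdTurnFun_cube (x : AddCircle (1 : ℝ)) :
    thirdTurnFun (thirdTurnFun (thirdTurnFun x)) = x := by
  have h : AffineOnWord (thirdTurnFun ∘ thirdTurnFun ∘ thirdTurnFun) [] [] :=
    (AffineOnWord.comp thirdTurnFun_11 (thirdTurnFun_10.comp thirdTurnFun_0)).join
      ((AffineOnWord.comp (u := [true, false]) thirdTurnFun_0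
          (thirdTurnFun_11.comp thirdTurnFun_10)).join
        (AffineOnWord.comp thirdTurnFun_10 (thirdTurnFun_0.comp thirdTurnFun_11)))
  obtain ⟨y, hy, rfl⟩ := AddCircle.eq_coe_Ico x
  exact h y (Ico_subset_Icc_self hy)

/-- The order three homeomorphism of the circle that permutes the intervals `[0, 1/2]`,
`[1/2, 3/4]`, `[3/4, 1]` cyclically. -/
noncomputable def thirdTurn : AddCircle (1 : ℝ) ≃ₜ AddCircle (1 : ℝ) where
  toFun := thirdTurnFun
  invFun := fun x => thirdTurnFun (thirdTurnFun x)
  left_inv := thirdTurnFun_cube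
  right_inv := thirdTurnFun_cube
  continuous_toFun := continuous_thirdTurnFun
  continuous_invFun := continuous_thirdTurnFun.comp continuous_thirdTurnFun

theorem thirdTurn_0 : AffineOnWord thirdTurn [false] [true, false] := thirdTurnFun_0
theorem thirdTurn_10 : AffineOnWord thirdTurn [true, false] [true, true] := thirdTurnFun_10
theorem thirdTurn_11 : AffineOnWord thirdTurn [true, true] [false] := thirdTurnFun_11

theorem isThompsonT_of_length_two {f : AddCircle (1 : ℝ) ≃ₜ AddCircle (1 : ℝ)}
    (hf : ∀ a b : Bool, ∃ v, AffineOnWord f [a, b] v) : IsThompsonT f := by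
  refine isThompsonT_of_affineOnWord f {u | u.length = 2} (List.finite_length_eq Bool 2) ?_ ?_
  · intro u hu
    obtain ⟨a, b, rfl⟩ := List.length_eq_two.1 hu
    exact hf a b
  · intro x hx
    obtain ⟨u, hu, s, hs, e⟩ := exists_stdMap_eq x hx 2
    exact ⟨u, hu, s, hs, e⟩

theorem isThompsonT_quarterTurn : IsThompsonT quarterTurn :=
  isThompsonT_of_length_two fun a b => match a, b with
    | false, false => ⟨_, quarterTurn_00⟩
    | false, true => ⟨_, quarterTurn_01⟩
    | true, false => ⟨_, quarterTurn_10⟩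
    | true, true => ⟨_, quarterTurn_11⟩

theorem isThompsonT_thirdTurn : IsThompsonT thirdTurn :=
  isThompsonT_of_length_two fun a b => match a, b with
    | false, b => ⟨_, thirdTurn_0.append [b]⟩
    | true, false => ⟨_, thirdTurn_10⟩
    | true, true => ⟨_, thirdTurn_11⟩

theorem quarterTurn_pow : quarterTurn ^ 4 = 1 := by
  refine eq_one_of_affineOnWord_nil ?_
  rw [show quarterTurn ^ 4 = quarterTurn * (quarterTurn * (quarterTurn * quarterTurn)) by
    simp only [pow_succ, pow_zero, one_mul, mul_assoc]]
  have h00 := quarterTurn_00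
  have h01 := quarterTurn_01
  have h10 := quarterTurn_10
  have h11 := quarterTurn_11
  exact ((h11.mul (h10.mul (h01.mul h00))).join (u := [false]) (v := [false])
      (h00.mul (h11.mul (h10.mul h01)))).join
    ((h01.mul (h00.mul (h11.mul h10))).join (u := [true]) (v := [true])
      (h10.mul (h01.mul (h00.mul h11))))

theorem thirdTurn_pow : thirdTurn ^ 3 = 1 := by
  ext x
  exact thirdTurnFun_cube x

/-- The product permutes five intervals affinely in the cycle `00 → 101 → 01 → 11 → 100 → 00`. -/
theorem thirdTurn_mul_quarterTurn_pow : (thirdTurn * quarterTurn) ^ 5 = 1 := by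
  have h0 : AffineOnWord (thirdTurn * quarterTurn : AddCircle (1 : ℝ) ≃ₜ AddCircle (1 : ℝ))
      [false, false] [true, false, true] := (thirdTurn_0.append [true]).mul quarterTurn_00
  have h1 : AffineOnWord (thirdTurn * quarterTurn : AddCircle (1 : ℝ) ≃ₜ AddCircle (1 : ℝ))
      [true, false, true] [false, true] :=
    (thirdTurn_11.append [true]).mul (quarterTurn_10.append [true])
  have h2 : AffineOnWord (thirdTurn * quarterTurn : AddCircle (1 : ℝ) ≃ₜ AddCircle (1 : ℝ))
      [false, true] [true, true] := thirdTurn_10.mul quarterTurn_01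
  have h3 : AffineOnWord (thirdTurn * quarterTurn : AddCircle (1 : ℝ) ≃ₜ AddCircle (1 : ℝ))
      [true, true] [true, false, false] := (thirdTurn_0.append [false]).mul quarterTurn_11
  have h4 : AffineOnWord (thirdTurn * quarterTurn : AddCircle (1 : ℝ) ≃ₜ AddCircle (1 : ℝ))
      [true, false, false] [false, false] :=
    (thirdTurn_11.append [false]).mul (quarterTurn_10.append [false])
  refine eq_one_of_affineOnWord_nil ?_
  generalize thirdTurn * quarterTurn = g at *
  rw [show g ^ 5 = g * (g * (g * (g * g))) by simp only [pow_succ, pow_zero, one_mul, mul_assoc]]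
  refine AffineOnWord.join (.join (u := [false]) (v := [false]) ?_ ?_)
    (.join (u := [true]) (v := [true])
      (.join (u := [true, false]) (v := [true, false]) ?_ ?_) ?_)
  · exact h4.mul (h3.mul (h2.mul (h1.mul h0)))
  · exact h1.mul (h0.mul (h4.mul (h3.mul h2)))
  · exact h3.mul (h2.mul (h1.mul (h0.mul h4)))
  · exact h0.mul (h4.mul (h3.mul (h2.mul h1)))
  · exact h2.mul (h1.mul (h0.mul (h4.mul h3)))

/-! ### The subgroup generated by the turns -/

/-- The subgroup generated by the two torsion elements `quarterTurn` and `thirdTurn`. -/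
noncomputable def turnSubgroup : Subgroup (AddCircle (1 : ℝ) ≃ₜ AddCircle (1 : ℝ)) :=
  Subgroup.closure {quarterTurn, thirdTurn}

theorem quarterTurn_mem : quarterTurn ∈ turnSubgroup := Subgroup.subset_closure (by simp)

theorem thirdTurn_mem : thirdTurn ∈ turnSubgroup := Subgroup.subset_closure (by simp)

theorem turnSubgroup_le : turnSubgroup ≤ ThompsonT := by
  refine (Subgroup.closure_le _).2 ?_
  rintro g (rfl | rfl)
  · exact isThompsonT_quarterTurn
  · exact isThompsonT_thirdTurn

/-- The rotation of the circle by a half turn. -/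
noncomputable def halfTurn : AddCircle (1 : ℝ) ≃ₜ AddCircle (1 : ℝ) := quarterTurn * quarterTurn

theorem halfTurn_mem : halfTurn ∈ turnSubgroup := mul_mem quarterTurn_mem quarterTurn_mem

theorem halfTurn_0 : AffineOnWord halfTurn [false] [true] :=
  (quarterTurn_01.mul quarterTurn_00).join (u := [false]) (v := [true])
    (quarterTurn_10.mul quarterTurn_01)

theorem halfTurn_1 : AffineOnWord halfTurn [true] [false] :=
  (quarterTurn_11.mul quarterTurn_10).join (u := [true]) (v := [false])
    (quarterTurn_00.mul quarterTurn_11)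

/-- The generator of Thompson's group `F` with pieces `[0, 1/4]`, `[1/4, 1/2]`, `[1/2, 1]`. -/
noncomputable def shiftRoot : AddCircle (1 : ℝ) ≃ₜ AddCircle (1 : ℝ) := thirdTurn⁻¹ * halfTurn

theorem shiftRoot_mem : shiftRoot ∈ turnSubgroup := mul_mem (inv_mem thirdTurn_mem) halfTurn_mem

theorem shiftRoot_00 : AffineOnWord shiftRoot [false, false] [false] :=
  thirdTurn_0.symm.mul (halfTurn_0.append [false])

theorem shiftRoot_01 : AffineOnWord shiftRoot [false, true] [true, false] :=
  thirdTurn_10.symm.mul (halfTurn_0.append [true])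

theorem shiftRoot_1 : AffineOnWord shiftRoot [true] [true, true] :=
  thirdTurn_11.symm.mul halfTurn_1

/-- The copy of `shiftRoot` supported in `[1/2, 1]`. -/
noncomputable def shiftRight : AddCircle (1 : ℝ) ≃ₜ AddCircle (1 : ℝ) :=
  thirdTurn⁻¹ * (quarterTurn⁻¹ * thirdTurn⁻¹)

theorem shiftRight_mem : shiftRight ∈ turnSubgroup :=
  mul_mem (inv_mem thirdTurn_mem) (mul_mem (inv_mem quarterTurn_mem) (inv_mem thirdTurn_mem))

theorem shiftRight_0 : AffineOnWord shiftRight [false] [false] :=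
  thirdTurn_0.symm.mul (quarterTurn_10.symm.mul thirdTurn_11.symm)

theorem shiftRight_100 : AffineOnWord shiftRight [true, false, false] [true, false] :=
  thirdTurn_10.symm.mul (quarterTurn_11.symm.mul (thirdTurn_0.symm.append [false]))

theorem shiftRight_101 : AffineOnWord shiftRight [true, false, true] [true, true, false] :=
  (thirdTurn_11.symm.append [false]).mul
    (quarterTurn_00.symm.mul (thirdTurn_0.symm.append [true]))

theorem shiftRight_11 : AffineOnWord shiftRight [true, true] [true, true, true] :=
  (thirdTurn_11.symm.append [true]).mul (quarterTurn_01.symm.mul thirdTurn_10.symm)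

/-- The subgroup acts transitively on the standard intervals of length at most `1/2`. -/
theorem exists_mem_turnSubgroup_affineOnWord (w : List Bool) (b : Bool) :
    ∃ h ∈ turnSubgroup, AffineOnWord h [false] (b :: w) := by
  have key : ∀ w, (∃ h ∈ turnSubgroup, AffineOnWord h [false] (false :: w)) →
      ∀ b, ∃ h ∈ turnSubgroup, AffineOnWord h [false] (b :: w) := by
    rintro w ⟨h, hh, hw⟩ b
    cases b with
    | false => exact ⟨h, hh, hw⟩
    | true => exact ⟨halfTurn * h, mul_mem halfTurn_mem hh, (halfTurn_0.append w).mul hw⟩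
  induction w generalizing b with
  | nil => exact key [] ⟨1, one_mem _, affineOnWord_one _⟩ b
  | cons c w ih =>
    -- The half turn exchanges the first letters. From `0w`, one third turn gives `10w` and two give
    -- `11w`; a half turn then gives `00w` or `01w`.
    refine key _ ?_ b
    obtain ⟨h, hh, hw⟩ := ih false
    have h1 := (thirdTurn_0.append w).mul hw
    have m1 := mul_mem thirdTurn_mem hh
    cases c with
    | false => exact ⟨_, mul_mem halfTurn_mem m1, (halfTurn_1.append (false :: w)).mul h1⟩
    | true =>
      exact ⟨_, mul_mem halfTurn_mem (mul_mem thirdTurn_mem m1),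
        (halfTurn_1.append (true :: w)).mul ((thirdTurn_10.append w).mul h1)⟩

/-! ### The turns generate `T` -/

namespace AffineOnTree

variable {f g : AddCircle (1 : ℝ) ≃ₜ AddCircle (1 : ℝ)} {t : BinTree} {u : List Bool}

theorem exists_word {f : AddCircle (1 : ℝ) → AddCircle (1 : ℝ)} (h : AffineOnTree f t u) :
    ∃ w v, AffineOnWord f (u ++ w) v := by
  induction t generalizing u with
  | leaf =>
    obtain ⟨v, hv⟩ := h
    exact ⟨[], v, by simpa using hv⟩
  | node a b iha _ =>
    obtain ⟨w, v, hv⟩ := iha h.1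
    exact ⟨false :: w, v, by simpa using hv⟩

theorem mul_right {u' : List Bool} (h : AffineOnTree f t u) (hg : AffineOnWord g u' u) :
    AffineOnTree (f * g : AddCircle (1 : ℝ) ≃ₜ AddCircle (1 : ℝ)) t u' := by
  induction t generalizing u u' with
  | leaf =>
    obtain ⟨v, hv⟩ := h
    exact ⟨v, hv.mul hg⟩
  | node a b iha ihb => exact ⟨iha h.1 (hg.append _), ihb h.2 (hg.append _)⟩

theorem mul_left (h : AffineOnTree f t u)
    (hg : ∀ w v, AffineOnWord f (u ++ w) v → ∃ v', AffineOnWord g v v') :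
    AffineOnTree (g * f : AddCircle (1 : ℝ) ≃ₜ AddCircle (1 : ℝ)) t u := by
  induction t generalizing u with
  | leaf =>
    obtain ⟨v, hv⟩ := h
    obtain ⟨v', hv'⟩ := hg [] v (by simpa using hv)
    exact ⟨v', hv'.mul hv⟩
  | node a b iha ihb =>
    exact ⟨iha h.1 fun w v hv => hg (false :: w) v (by simpa using hv),
      ihb h.2 fun w v hv => hg (true :: w) v (by simpa using hv)⟩

end AffineOnTree

/-- The number of leaves of a binary tree. -/
def BinTree.numLeaves : BinTree → ℕ
  | .leaf => 1
  | .node a b => a.numLeaves + b.numLeaves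

theorem eq_replicate_of_stdMap_zero {v : List Bool} (h : stdMap v 0 = 0) :
    v = List.replicate v.length false := by
  induction v with
  | nil => rfl
  | cons b v ih =>
    have h0 := (stdMap_mem_Icc v (s := 0) (by simp)).1
    cases b with
    | false =>
      rw [List.length_cons, List.replicate_succ, ← ih (by simpa [stdMap] using h)]
    | true =>
      simp only [stdMap, if_true] at h
      linarith

/-- An interval adjacent on the right to a fixed interval `[0, 1/2]` goes to an interval starting
at `1/2`. -/
theorem AffineOnWord.exists_replicate {f : AddCircle (1 : ℝ) ≃ₜ AddCircle (1 : ℝ)} {v : List Bool}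
    (k : ℕ) (h0 : AffineOnWord f [false] [false])
    (h : AffineOnWord f (true :: List.replicate k false) v) :
    ∃ b, v = true :: List.replicate b false := by
  have hrep : ∀ k : ℕ, stdMap (List.replicate k false) 0 = 0 := by
    intro k
    induction k with
    | zero => rfl
    | succ k ih => simp [List.replicate_succ, stdMap, ih]
  have hv := h.incomp f.injective h0 (by simp)
  have e : ((stdMap v 0 : ℝ) : AddCircle (1 : ℝ)) = (1 / 2 : ℝ) := by
    rw [← h 0 (by simp)]
    have := h0 1 (by simp)
    simpa [stdMap, hrep] using this
  obtain ⟨j, hj⟩ := exists_eq_add_int_of_coe_eq e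
  obtain ⟨l0, l1⟩ := stdMap_mem_Icc v (s := 0) (by simp)
  rw [hj] at l0 l1
  have j0 : (-1 : ℝ) < j := by linarith
  have j1 : (j : ℝ) < 1 := by linarith
  have j0' : -1 < j := by exact_mod_cast j0
  have j1' : j < 1 := by exact_mod_cast j1
  obtain rfl : j = 0 := by omega
  match v, hv, hj with
  | [], hv, _ => simp at hv
  | false :: v, hv, _ => simp at hv
  | true :: v, _, hj =>
    simp only [stdMap, if_true] at hj
    exact ⟨v.length, by rw [← eq_replicate_of_stdMap_zero (v := v) (by push_cast at hj; linarith)]⟩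

/-- The image of `[1/2, 1]` starts at `1/2`. Were it shorter than `1/2`, its right end would miss
the fixed point `0 = 1`. -/
theorem eq_one_of_affineOnTree_leaf {f : AddCircle (1 : ℝ) ≃ₜ AddCircle (1 : ℝ)}
    (h0 : AffineOnWord f [false] [false]) (h : AffineOnTree f .leaf [true]) : f = 1 := by
  obtain ⟨v, hv⟩ := h
  obtain ⟨b, rfl⟩ := AffineOnWord.exists_replicate 0 h0 hv
  cases b with
  | zero => exact eq_one_of_affineOnWord_nil (AffineOnWord.join h0 hv)
  | succ b =>
    exfalso
    have e1 := hv 1 (by simp)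
    have e0 := h0 0 (by simp)
    have e2 : ((stdMap [true] 1 : ℝ) : AddCircle (1 : ℝ)) = (stdMap [false] 0 : ℝ) :=
      coe_eq_coe_of_eq_add_one (by norm_num [stdMap])
    rw [e2, e0] at e1
    obtain ⟨j, hj⟩ := exists_eq_add_int_of_coe_eq e1
    obtain ⟨l0, l1⟩ := stdMap_mem_Icc (List.replicate b false) (s := 1) (by simp)
    simp only [List.replicate_succ, stdMap, Bool.false_eq_true, if_false, if_true] at hj
    have j0 : (-1 : ℝ) < j := by linarith
    have j1 : (j : ℝ) < 0 := by linarith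
    have j0' : -1 < j := by exact_mod_cast j0
    have j1' : j < 0 := by exact_mod_cast j1
    omega

/-- Every homeomorphism that fixes `[0, 1/2]` and maps a subdivision of `[1/2, 1]` affinely onto
standard intervals belongs to the subgroup. -/
theorem mem_turnSubgroup_of_affineOnTree (n : ℕ) :
    ∀ (t : BinTree), t.numLeaves = n → ∀ f : AddCircle (1 : ℝ) ≃ₜ AddCircle (1 : ℝ),
      AffineOnWord f [false] [false] → AffineOnTree f t [true] → f ∈ turnSubgroup := by
  induction n using Nat.strong_induction_on with
  | _ n ih =>
  intro t ht
  cases t with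
  | leaf =>
    intro f h0 h
    rw [eq_one_of_affineOnTree_leaf h0 h]
    exact one_mem _
  | node l r =>
  induction l generalizing r with
  | node a b iha _ =>
    intro f h0 ⟨⟨ha, hb⟩, hr⟩
    -- Precomposing with `shiftRight⁻¹` rotates `(a b) r` into `a (b r)`: the leaf count stays the
    -- same and the left subtree shrinks.
    rw [← mul_mem_cancel_right (inv_mem shiftRight_mem)]
    exact iha (.node b r) (by simpa only [BinTree.numLeaves, add_assoc] using ht) _
      (h0.mul shiftRight_0.symm)
      ⟨ha.mul_right shiftRight_100.symm, hb.mul_right shiftRight_101.symm,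
        hr.mul_right shiftRight_11.symm⟩
  | leaf =>
    rintro f h0 ⟨⟨v, hv⟩, hr⟩
    obtain ⟨b, rfl⟩ := AffineOnWord.exists_replicate 1 h0 hv
    -- Images of the remaining pieces avoid those of `[0, 1/2]` and `[1/2, 3/4]`; hence the shifts
    -- applied below are affine on them.
    have hdisj : ∀ b (f : AddCircle (1 : ℝ) ≃ₜ AddCircle (1 : ℝ)) w x,
        AffineOnWord f [false] [false] →
        AffineOnWord f [true, false] (true :: List.replicate b false) →
        AffineOnWord f ([true, true] ++ w) x →
        WordIncomp x (true :: List.replicate b false) ∧ WordIncomp x [false] :=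
      fun b f w x h0 hv hx =>
        ⟨hx.incomp f.injective hv (by simp), hx.incomp f.injective h0 (by simp)⟩
    rcases b with _ | b
    -- Here `[1/2, 3/4]` already fills `[1/2, 1]`, leaving no room for the other pieces.
    · exfalso
      obtain ⟨w, x, hx⟩ := hr.exists_word
      have hd := hdisj _ f w x h0 hv hx
      match x, hd with
      | [], hd => simp at hd
      | true :: x, hd => simp at hd
      | false :: x, hd => simp at hd
    induction b generalizing f with
    | zero =>
      -- Now `f` fixes `[0, 3/4]`, which `shiftRoot` identifies with `[0, 1/2]`; the conjugate needs
      -- only the subdivision `r`, with one leaf fewer.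
      have hmem : shiftRoot⁻¹ * f * shiftRoot ∈ turnSubgroup := by
        refine ih r.numLeaves (by simp only [BinTree.numLeaves] at ht; omega) r rfl _ ?_ ?_
        · exact AffineOnWord.join (u := [false]) (v := [false])
            ((shiftRoot_00.symm.mul h0).mul shiftRoot_00)
            ((shiftRoot_01.symm.mul hv).mul shiftRoot_01)
        · refine AffineOnTree.mul_right (hr.mul_left fun w x hx => ?_) shiftRoot_1
          have hd := hdisj _ f w x h0 hv hx
          match x, hd with
          | [], hd => simp at hd
          | false :: x, hd => simp at hd
          | [true], hd => simp at hd
          | true :: false :: x, hd => simp at hd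
          | true :: true :: x, _ => exact ⟨_, shiftRoot_1.symm.append x⟩
      rwa [mul_mem_cancel_right shiftRoot_mem,
        mul_mem_cancel_left (inv_mem shiftRoot_mem)] at hmem
    | succ b ihb =>
      -- Postcomposing with `shiftRight` doubles the image of `[1/2, 3/4]`.
      rw [← mul_mem_cancel_left shiftRight_mem]
      refine ihb _ (shiftRight_0.mul h0) (hr.mul_left fun w x hx => ?_)
        ((shiftRight_100.append (List.replicate b false)).mul hv)
      have hd := hdisj _ f w x h0 hv hx
      match x, hd with
      | [], hd => simp at hd
      | false :: x, hd => simp at hd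
      | [true], hd => simp at hd
      | [true, false], hd => simp [List.replicate_succ] at hd
      | true :: false :: false :: x, _ => exact ⟨_, shiftRight_100.append x⟩
      | true :: false :: true :: x, _ => exact ⟨_, shiftRight_101.append x⟩
      | true :: true :: x, _ => exact ⟨_, shiftRight_11.append x⟩

theorem thompsonT_le_turnSubgroup : ThompsonT ≤ turnSubgroup := by
  intro f hf
  obtain ⟨t, ht⟩ := IsThompsonT.exists_affineOnTree hf [false]
  obtain ⟨w, v, hv⟩ := ht.exists_word
  -- The appended letter keeps the image word nonempty even when `v` is empty, so transitivity
  -- applies to it.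
  obtain ⟨h, hh, hu⟩ := exists_mem_turnSubgroup_affineOnWord (w ++ [false]) false
  obtain ⟨h', hh', hu'⟩ : ∃ h ∈ turnSubgroup, AffineOnWord h [false] (v ++ [false]) := by
    cases v with
    | nil => exact exists_mem_turnSubgroup_affineOnWord [] false
    | cons b v => exact exists_mem_turnSubgroup_affineOnWord (v ++ [false]) b
  have h0 : AffineOnWord (h'⁻¹ * f * h : AddCircle (1 : ℝ) ≃ₜ AddCircle (1 : ℝ))
      [false] [false] :=
    (hu'.symm.mul (hv.append [false])).mul hu
  have hT : IsThompsonT (h'⁻¹ * f * h) :=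
    mul_mem (S := Subgroup _) (s := ThompsonT)
      (mul_mem (inv_mem (turnSubgroup_le hh')) hf) (turnSubgroup_le hh)
  obtain ⟨t', ht'⟩ := hT.exists_affineOnTree [true]
  have hmem := mem_turnSubgroup_of_affineOnTree _ t' rfl _ h0 ht'
  rwa [mul_mem_cancel_right hh, mul_mem_cancel_left (inv_mem hh')] at hmem

/-! ### The global fixed vertex -/

theorem ThompsonT.hasFixedVertex {V : Type*} {Γ : SimpleGraph V} (hΓ : Γ.IsTree)
    (ρ : ThompsonT →* (Γ ≃g Γ)) : HasFixedVertex ρ := by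
  let a : ThompsonT := ⟨quarterTurn, isThompsonT_quarterTurn⟩
  let b : ThompsonT := ⟨thirdTurn, isThompsonT_thirdTurn⟩
  have ha : a ^ 4 = 1 := Subtype.ext quarterTurn_pow
  have hb : b ^ 3 = 1 := Subtype.ext thirdTurn_pow
  have hba : (b * a) ^ 5 = 1 := Subtype.ext thirdTurn_mul_quarterTurn_pow
  -- The pair `b * a`, `b⁻¹` is chosen because both have odd order, while their product `a` need
  -- only have finite order.
  obtain ⟨x, hx, hx'⟩ := hΓ.exists_common_fixed (ρ (b * a)) (ρ b⁻¹) (n := 4)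
    (hΓ.exists_apply_eq_self_of_odd _ (n := 5) (by decide) (by rw [← map_pow, hba, map_one]))
    (hΓ.exists_apply_eq_self_of_odd _ (n := 3) (by decide)
      (by rw [← map_pow, inv_pow, hb, inv_one, map_one]))
    four_ne_zero (by rw [← map_mul, inv_mul_cancel_left, ← map_pow, ha, map_one])
  let K : Subgroup ThompsonT :=
    { carrier := {g | ρ g x = x}
      one_mem' := by
        change ρ 1 x = x
        rw [map_one]
        rfl
      mul_mem' := fun {g h} hg hh => by
        change ρ (g * h) x = x
        rw [map_mul]
        change ρ g (ρ h x) = x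
        rw [hh, hg]
      inv_mem' := fun {g} hg => by
        change ρ g⁻¹ x = x
        conv_lhs => rw [← show ρ g x = x from hg]
        change (ρ g⁻¹ * ρ g) x = x
        rw [← map_mul, inv_mul_cancel, map_one]
        rfl }
  have hKb : b ∈ K := inv_mem_iff.1 (show b⁻¹ ∈ K from hx')
  have hKa : a ∈ K := (mul_mem_cancel_left hKb).1 (show b * a ∈ K from hx)
  have hle : turnSubgroup ≤ K.map ThompsonT.subtype := by
    refine (Subgroup.closure_le _).2 ?_
    rintro g (rfl | rfl)
    · exact ⟨a, hKa, rfl⟩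
    · exact ⟨b, hKb, rfl⟩
  refine ⟨x, fun g => ?_⟩
  obtain ⟨g', hg', e⟩ := hle (thompsonT_le_turnSubgroup g.2)
  rw [← show g' = g from Subtype.ext e]
  exact hg'

theorem theorem4p3 : HasPropertyFA.{v, 0} ThompsonT := by
  intro V Γ hΓ ρ
  exact ⟨Or.inl (ThompsonT.hasFixedVertex hΓ ρ), fun _ => ThompsonT.hasFixedVertex hΓ ρ⟩
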